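/- A \emph{tree order} is a partially ordered set $(E,\le)$ such that for every $e\in E$ the set ${\downarrow}e=\{x\in E\mid x\le e\}$ is finite and totally ordered by $\le$. Its \emph{immediate predecessor function} $i_E:E\to E\sqcup\{\ast\}$ sends $e$ to $\max({\downarrow}e\smallsetminus\{e\})$ if ${\downarrow}e\neq\{e\}$ and to $\ast$ otherwise. A monotone map $f:(E,\le)\to(F,\le)$ between tree orders is \emph{strict} if $i_F\circ f=f_\ast\circ i_E$, where $f_\ast:E\sqcup\{\ast\}\to F\sqcup\{\ast\}$ extends $f$ by $\ast\mapsto\ast$. Let $\mathbf{Tree}$ be the category of tree orders and strict monotone maps. A \emph{hierarchical graph} $\mathcal G$ consists of a tree order $(E_{\mathcal G},\le)$ of edges, a set $V_{\mathcal G}$ of nodes, and functions $s_{\mathcal G},t_{\mathcal G}:E_{\mathcal G}\rightrightarrows V_{\mathcal G}$. A morphism $\mathcal G\to\mathcal H$ is a pair $(f,g)$ of a morphism $f:(E_{\mathcal G},\le)\to(E_{\mathcal H},\le)$ of $\mathbf{Tree}$ and a function $g:V_{\mathcal G}\to V_{\mathcal H}$ such that $s_{\mathcal H}\circ f=g\circ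 s_{\mathcal G}$ and $t_{\mathcal H}\circ f=g\circ t_{\mathcal G}$. With componentwise composition these form a category $\mathbf{HGraph}$. \textbf{Theorem.} The category $\mathbf{HGraph}$ is adhesive: pullbacks along monomorphisms exist, pushouts along monomorphisms exist, and every pushout along a monomorphism is a Van Kampen square. (A pushout square is Van Kampen if, for every commutative cube having it as bottom face and whose two back faces are pullbacks, the top face is a pushout if and only if the two front faces are pullbacks.) -/

import Mathlib

open CategoryTheory

universe u

namespace HierGraph

/-- A partial order is a *tree order* if every down-set `{x | x ≤ e}` is a finite chain. -/
class IsTreeOrder (E : Type u) [PartialOrder E] : Prop where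
  finite_Iic : ∀ e : E, (Set.Iic e).Finite
  isChain_Iic : ∀ e : E, IsChain (· ≤ ·) (Set.Iic e)

/-- In a tree order, an element that is not minimal has a largest strict predecessor. -/
theorem exists_isGreatest_pred {E : Type u} [PartialOrder E] [IsTreeOrder E] {e : E}
    (h : Set.Iic e ≠ {e}) : ∃ p, IsGreatest (Set.Iic e \ {e}) p := by
  have hne : (Set.Iic e \ {e}).Nonempty := by
    by_contra hcon
    rw [Set.not_nonempty_iff_eq_empty, Set.sdiff_eq_empty] at hcon
    exact h (Set.Subset.antisymm hcon (Set.singleton_subset_iff.2 le_rfl))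
  obtain ⟨p, hp⟩ := ((IsTreeOrder.finite_Iic e).subset Set.sdiff_subset).exists_maximal hne
  refine ⟨p, hp.prop, fun q hq => ?_⟩
  rcases (IsTreeOrder.isChain_Iic e).total hq.1 hp.prop.1 with hqp | hpq
  · exact hqp
  · exact hp.le_of_ge hq hpq

open Classical in
/-- The immediate predecessor function `E → E ⊔ {∗}` of a tree order (`none` plays the role of
`∗`): it sends `e` to the maximum of `{x | x ≤ e} \ {e}`, and to `∗` if `{x | x ≤ e} = {e}`. -/
noncomputable def immPred {E : Type u} [PartialOrder E] [IsTreeOrder E] (e : E) : Option E :=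
  if h : Set.Iic e = {e} then none else some (exists_isGreatest_pred h).choose

/-- A monotone map between tree orders is *strict* if it commutes with the immediate predecessor
functions (where `∗` is sent to `∗`). -/
def IsStrict {E F : Type u} [PartialOrder E] [IsTreeOrder E] [PartialOrder F] [IsTreeOrder F]
    (f : E →o F) : Prop :=
  ∀ e : E, immPred (f e) = (immPred e).map f

/-- The objects of the category `Tree`: (small) tree orders. -/
structure TreeOrd : Type (u + 1) where
  carrier : Type u
  [partialOrder : PartialOrder carrier]
  [isTreeOrder : IsTreeOrder carrier]

namespace TreeOrd

instance : CoeSort TreeOrd.{u} (Type u) := ⟨TreeOrd.carrier⟩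

instance (E : TreeOrd.{u}) : PartialOrder E := E.partialOrder

instance (E : TreeOrd.{u}) : IsTreeOrder E := E.isTreeOrder

/-- The morphisms of the category `Tree`: strict monotone maps. -/
@[ext]
structure Hom (E F : TreeOrd.{u}) : Type u where
  toOrderHom : E →o F
  strict : IsStrict toOrderHom

/-- The category `Tree` of tree orders and strict monotone maps. -/
instance : Category TreeOrd.{u} where
  Hom E F := Hom E F
  id E := ⟨OrderHom.id, fun e => by simp⟩
  comp f g := ⟨g.toOrderHom.comp f.toOrderHom, fun e => by
    simp [g.strict (f.toOrderHom e), f.strict e, Function.comp_def]⟩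

end TreeOrd

end HierGraph

open HierGraph in
/-- A *hierarchical graph*: a tree order of edges, a set of nodes, and source and target maps. -/
structure HGraph : Type (u + 1) where
  edges : TreeOrd.{u}
  nodes : Type u
  src : edges → nodes
  tgt : edges → nodes

namespace HGraph

/-- A morphism of hierarchical graphs: a morphism in `Tree` between the edges and a function
between the nodes, commuting with source and target. -/
@[ext]
structure Hom (G H : HGraph.{u}) : Type u where
  edgeMap : G.edges ⟶ H.edges
  nodeMap : G.nodes → H.nodes
  src_comm : ∀ e : G.edges, H.src (edgeMap.toOrderHom e) = nodeMap (G.src e)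
  tgt_comm : ∀ e : G.edges, H.tgt (edgeMap.toOrderHom e) = nodeMap (G.tgt e)

/-- The category `HGraph` of hierarchical graphs, with componentwise composition. -/
instance : Category HGraph.{u} where
  Hom G H := Hom G H
  id G := ⟨𝟙 G.edges, id, fun _ => rfl, fun _ => rfl⟩
  comp f g := ⟨f.edgeMap ≫ g.edgeMap, g.nodeMap ∘ f.nodeMap,
    fun e => (g.src_comm _).trans (congrArg g.nodeMap (f.src_comm e)),
    fun e => (g.tgt_comm _).trans (congrArg g.nodeMap (f.tgt_comm e))⟩

end HGraph

/-! A tree order amounts to a parent function `E → Option E` that lowers some rank in `ℕ`, and a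
strict map to a function commuting with parents, monotonicity being automatic. Limits and colimits
then need only be built on sets. A parent function extends to a pullback of sets because strictness
makes matching edges have matching parents, and to a pushout because strictness makes it constant on
glued edges; depth supplies the rank in both cases. So all pullbacks and pushouts exist, and
`elements`, sending a graph to edges ⊕ nodes, preserves them. It also reflects isomorphisms, since
the inverse of a bijective strict map is strict. Adhesivity of `Type u` therefore transfers to
`HGraph`. -/

open Limits

namespace HierGraph

/-! ### Tree orders through immediate predecessors -/

section Parent

variable {E : Type u} [PartialOrder E] [IsTreeOrder E]

theorem immPred_eq_none_iff {e : E} : immPred e = none ↔ Set.Iic e = {e} := by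
  unfold immPred
  split_ifs with h <;> simp [h]

theorem immPred_eq_some_iff {e q : E} : immPred e = some q ↔ IsGreatest (Set.Iio e) q := by
  have hset : Set.Iic e \ {e} = Set.Iio e := by
    ext x
    simp [lt_iff_le_and_ne]
  unfold immPred
  split_ifs with h
  · rw [← hset, h]
    simp [IsGreatest]
  · have hc : IsGreatest (Set.Iio e) (exists_isGreatest_pred h).choose :=
      hset ▸ (exists_isGreatest_pred h).choose_spec
    rw [Option.some_inj]
    exact ⟨fun hq => hq ▸ hc, fun hq => hc.unique hq⟩

/-- The number of elements below a given element of a tree order. -/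
noncomputable def depth (e : E) : ℕ := (Set.Iic e).ncard

theorem depth_eq_one {e : E} (h : immPred e = none) : depth e = 1 := by
  rw [depth, immPred_eq_none_iff.1 h, Set.ncard_singleton]

theorem depth_eq_succ {e q : E} (h : immPred e = some q) : depth e = depth q + 1 := by
  have hq := immPred_eq_some_iff.1 h
  have hIic : Set.Iic e = insert e (Set.Iic q) := by
    ext x
    constructor
    · intro hx
      rcases eq_or_lt_of_le (Set.mem_Iic.1 hx) with rfl | hlt
      · exact Set.mem_insert _ _
      · exact Set.mem_insert_of_mem _ (hq.2 hlt)
    · rintro (rfl | hx)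
      · exact le_rfl
      · exact le_trans hx (le_of_lt hq.1)
  rw [depth, hIic, Set.ncard_insert_of_notMem _ (IsTreeOrder.finite_Iic q), depth]
  exact fun hmem => absurd (Set.mem_Iic.1 hmem) (not_le_of_gt hq.1)

theorem le_of_immPred_eq_some {e q : E} (h : immPred e = some q) : q ≤ e :=
  le_of_lt (immPred_eq_some_iff.1 h).1

/-- Induction along the immediate predecessor function. -/
theorem immPred_induction {P : E → Prop} (root : ∀ e, immPred e = none → P e)
    (step : ∀ e q, immPred e = some q → P q → P e) (e : E) : P e := by
  induction hn : depth e using Nat.strong_induction_on generalizing e with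
  | _ n ih =>
    cases h : immPred e with
    | none => exact root e h
    | some q =>
      have := depth_eq_succ h
      exact step e q h (ih (depth q) (by omega) q rfl)

/-- Anything strictly below `e` lies below its predecessor, so induction along predecessors applies.
-/
theorem monotone_of_immPred {F : Type u} [PartialOrder F] [IsTreeOrder F] {f : E → F}
    (h : ∀ e, immPred (f e) = (immPred e).map f) : Monotone f := by
  intro x e
  induction e using immPred_induction with
  | root e he =>
    intro hx
    have hx' : x ∈ Set.Iic e := hx
    rw [immPred_eq_none_iff.1 he] at hx'
    rw [Set.mem_singleton_iff.1 hx']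
  | step e q he ih =>
    intro hx
    rcases eq_or_lt_of_le hx with rfl | hlt
    · exact le_rfl
    · refine (ih ((immPred_eq_some_iff.1 he).2 hlt)).trans (le_of_immPred_eq_some ?_)
      rw [h, he, Option.map_some]

/-- This invariance lets depth descend to a pushout and serve there as the rank. -/
theorem depth_map {F : Type u} [PartialOrder F] [IsTreeOrder F] {f : E → F}
    (h : ∀ e, immPred (f e) = (immPred e).map f) (e : E) : depth (f e) = depth e := by
  induction e using immPred_induction with
  | root e he => rw [depth_eq_one he, depth_eq_one (by rw [h, he, Option.map_none])]
  | step e q he ih =>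
    rw [depth_eq_succ he, depth_eq_succ (q := f q) (by rw [h, he, Option.map_some]), ih]

end Parent

namespace TreeOrd

/-- A function commuting with immediate predecessors, as a morphism of tree orders. -/
def homMk {E F : TreeOrd.{u}} (f : E → F) (h : ∀ e, immPred (f e) = (immPred e).map f) : E ⟶ F :=
  ⟨⟨f, monotone_of_immPred h⟩, h⟩

/-! ### Tree orders built from ranked parent functions -/

section OfParent

variable {E : Type u} (p : E → Option E) (d : E → ℕ) (hd : ∀ e q, p e = some q → d q < d e)

/-- The ancestor relation of a parent function. -/
def Ancestor (x e : E) : Prop := Relation.ReflTransGen (fun a b => p a = some b) e x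

include hd in
variable {p d} in
theorem Ancestor.eq_or_lt {x e : E} (h : Ancestor p x e) : x = e ∨ d x < d e := by
  induction h with
  | refl => exact .inl rfl
  | tail _ hbc ih =>
    have := hd _ _ hbc
    rcases ih with rfl | ih
    · exact .inr this
    · exact .inr (this.trans ih)

variable {p} in
theorem Ancestor.total {x y e : E} (hx : Ancestor p x e) (hy : Ancestor p y e) :
    Ancestor p x y ∨ Ancestor p y x :=
  (Relation.ReflTransGen.total_of_right_unique
    (fun _ _ _ hb hc => Option.some_injective _ (hb.symm.trans hc)) hx hy).symm

/-- The tree order in which `x ≤ e` if `x` is obtained from `e` by iterating a parent function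
that decreases some rank. -/
def ofParent : TreeOrd.{u} :=
  letI : PartialOrder E :=
    { le := Ancestor p
      le_refl := fun _ => Relation.ReflTransGen.refl
      le_trans := fun _ _ _ hxy hyz => Relation.ReflTransGen.trans hyz hxy
      le_antisymm := fun x y hxy hyx => by
        rcases Ancestor.eq_or_lt hd hxy with h | h
        · exact h
        · rcases Ancestor.eq_or_lt hd hyx with h' | h'
          · exact h'.symm
          · omega }
  { carrier := E
    isTreeOrder :=
      { finite_Iic := fun e => by
          -- The rank is injective on the chain below `e` and bounded there by `d e`.
          refine Set.Finite.of_injOn (f := d) (t := Set.Iic (d e)) ?_ ?_ (Set.finite_Iic _)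
          · intro x hx
            rcases Ancestor.eq_or_lt hd (show Ancestor p x e from hx) with rfl | h
            · exact Set.mem_Iic.2 (le_refl (d x))
            · exact Set.mem_Iic.2 (Nat.le_of_lt h)
          · intro x hx y hy hxy
            rcases Ancestor.total (p := p) hx hy with h | h <;>
              rcases Ancestor.eq_or_lt hd h with h' | h' <;> first | exact h' | exact h'.symm | omega
        isChain_Iic := fun e x hx y hy _ => Ancestor.total (p := p) hx hy } }

/-- A nontrivial path of parents starting at `e` passes through `p e` first, so `p e` is the
greatest strict ancestor. -/
theorem immPred_ofParent (e : ofParent p d hd) : immPred e = p e := by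
  apply Option.ext
  intro q
  have hhead : ∀ x : ofParent p d hd, x < e → ∃ c : E, p e = some c ∧ Ancestor p x c := by
    intro x hx
    rcases Relation.ReflTransGen.cases_head (show Ancestor p x e from hx.le) with h | h
    · exact absurd h hx.ne'
    · exact h
  have hparent : ∀ c : ofParent p d hd, p e = some c → c < e := by
    intro c hc
    refine lt_of_le_of_ne (show Ancestor p c e from .single hc) ?_
    rintro rfl
    exact lt_irrefl _ (hd _ _ hc)
  rw [immPred_eq_some_iff]
  constructor
  · intro hq
    obtain ⟨c, hc, hqc⟩ := hhead q hq.1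
    rw [hc]
    have hqc' : q ≤ (c : ofParent p d hd) := hqc
    exact congrArg some (le_antisymm (α := ofParent p d hd) (hq.2 (hparent c hc)) hqc')
  · intro hq
    refine ⟨hparent q hq, fun x hx => ?_⟩
    obtain ⟨c, hc, hxc⟩ := hhead x hx
    obtain rfl : c = q := Option.some_injective _ (hc.symm.trans hq)
    exact hxc

end OfParent

/-! ### Pullbacks of tree orders -/

section Pullback

variable {E F G : TreeOrd.{u}} (f : E ⟶ G) (g : F ⟶ G)

/-- By strictness the two predecessors have equal images in `Option G`; hence both are absent, or
both exist and form a point of the pullback. -/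
theorem exists_pullback_parent
    (x : {x : E × F // f.toOrderHom x.1 = g.toOrderHom x.2}) :
    ∃ q : Option {x : E × F // f.toOrderHom x.1 = g.toOrderHom x.2},
      immPred x.1.1 = q.map (fun y => y.1.1) ∧ immPred x.1.2 = q.map (fun y => y.1.2) := by
  have hf := f.strict x.1.1
  have hg := g.strict x.1.2
  rw [x.2, hg] at hf
  cases h₁ : immPred x.1.1 with
  | none =>
    rw [h₁] at hf
    exact ⟨none, rfl, by simpa using hf⟩
  | some a =>
    cases h₂ : immPred x.1.2 with
    | none => simp [h₁, h₂] at hf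
    | some b =>
      rw [h₁, h₂] at hf
      exact ⟨some ⟨(a, b), (Option.some_injective _ hf).symm⟩, rfl, rfl⟩

/-- The parent function on the pullback of two strict maps. -/
noncomputable def pullbackParent (x : {x : E × F // f.toOrderHom x.1 = g.toOrderHom x.2}) :
    Option {x : E × F // f.toOrderHom x.1 = g.toOrderHom x.2} :=
  (exists_pullback_parent f g x).choose

/-- The pullback of tree orders, on the pullback of the underlying sets. -/
noncomputable def pullbackObj : TreeOrd.{u} :=
  ofParent (pullbackParent f g) (fun x => depth x.1.1) (by
    intro x q hq
    have h := (exists_pullback_parent f g x).choose_spec.1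
    change _ = Option.map _ (pullbackParent f g x) at h
    rw [hq] at h
    exact (Nat.lt_succ_self _).trans_eq (depth_eq_succ h).symm)

/-- The first projection of the pullback. -/
noncomputable def pullbackFst : pullbackObj f g ⟶ E :=
  homMk (E := pullbackObj f g) (fun x => x.1.1) fun x => by
    exact (exists_pullback_parent f g x).choose_spec.1.trans
      (congrArg (Option.map _) (immPred_ofParent (pullbackParent f g) _ _ x).symm)

/-- The second projection of the pullback. -/
noncomputable def pullbackSnd : pullbackObj f g ⟶ F :=
  homMk (E := pullbackObj f g) (fun x => x.1.2) fun x => by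
    exact (exists_pullback_parent f g x).choose_spec.2.trans
      (congrArg (Option.map _) (immPred_ofParent (pullbackParent f g) _ _ x).symm)

/-- The morphism to the pullback induced by a pair of morphisms. -/
noncomputable def pullbackLift {T : TreeOrd.{u}} (a : T ⟶ E) (b : T ⟶ F)
    (h : ∀ t, f.toOrderHom (a.toOrderHom t) = g.toOrderHom (b.toOrderHom t)) :
    T ⟶ pullbackObj f g :=
  homMk (F := pullbackObj f g) (fun t => ⟨(a.toOrderHom t, b.toOrderHom t), h t⟩) fun t => by
    refine (immPred_ofParent _ _ _ _).trans ?_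
    have hs := (exists_pullback_parent f g ⟨(a.toOrderHom t, b.toOrderHom t), h t⟩).choose_spec
    change _ = Option.map _ (pullbackParent f g _) ∧ _ = Option.map _ (pullbackParent f g _) at hs
    -- The chosen parent matters only through its two projections, which determine it.
    generalize pullbackParent f g _ = q at hs ⊢
    have h₁ := (a.strict t).symm.trans hs.1
    have h₂ := (b.strict t).symm.trans hs.2
    cases ht : immPred t with
    | none =>
      rw [ht] at h₁
      cases q with
      | none => rfl
      | some q => simp at h₁
    | some s =>
      rw [ht] at h₁ h₂
      cases q with
      | none => simp at h₁
      | some q =>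
        exact congrArg some (Subtype.ext (Prod.ext (Option.some_injective _ h₁).symm
          (Option.some_injective _ h₂).symm))

end Pullback

end TreeOrd

/-! ### Pushouts of sets and of tree orders -/

/-- The pushout of two functions. -/
def FunPushout {A B C : Type u} (f : A → B) (g : A → C) : Type u :=
  Quot fun x y : B ⊕ C => ∃ a, x = .inl (f a) ∧ y = .inr (g a)

namespace FunPushout

variable {A B C : Type u} {f : A → B} {g : A → C}

/-- The first map into the pushout. -/
def inl (b : B) : FunPushout f g := Quot.mk _ (.inl b)

/-- The second map into the pushout. -/
def inr (c : C) : FunPushout f g := Quot.mk _ (.inr c)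

theorem condition (a : A) : (inl (f a) : FunPushout f g) = inr (g a) :=
  Quot.sound ⟨a, rfl, rfl⟩

/-- The map out of the pushout induced by a compatible pair of maps. -/
def desc {T : Type*} (b : B → T) (c : C → T) (h : ∀ a, b (f a) = c (g a)) :
    FunPushout f g → T :=
  Quot.lift (Sum.elim b c) (by rintro _ _ ⟨a, rfl, rfl⟩; exact h a)

@[elab_as_elim]
theorem ind {P : FunPushout f g → Prop} (hl : ∀ b, P (inl b)) (hr : ∀ c, P (inr c))
    (x : FunPushout f g) : P x := by
  rcases x with ⟨b | c⟩
  · exact hl b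
  · exact hr c

end FunPushout

namespace TreeOrd

section Pushout

variable {E F G : TreeOrd.{u}} (f : G ⟶ E) (g : G ⟶ F)

/-- The parent function on the pushout of two strict maps. -/
noncomputable def pushoutParent (x : FunPushout f.toOrderHom g.toOrderHom) :
    Option (FunPushout f.toOrderHom g.toOrderHom) :=
  FunPushout.desc (fun e => (immPred e).map FunPushout.inl)
    (fun e => (immPred e).map FunPushout.inr) (fun a => by
      -- By strictness both sides come from the predecessor of `a` in `G`, whose two images are
      -- glued.
      rw [f.strict, g.strict, Option.map_map, Option.map_map]
      exact congrArg (Option.map · _) (funext FunPushout.condition)) x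

/-- The pushout of tree orders, on the pushout of the underlying sets. -/
noncomputable def pushoutObj : TreeOrd.{u} :=
  ofParent (pushoutParent f g)
    (FunPushout.desc depth depth fun a => by rw [depth_map f.strict, depth_map g.strict]) (by
    intro x q hq
    induction x using FunPushout.ind with
    | hl e =>
      obtain ⟨r, hr, rfl⟩ := Option.map_eq_some_iff.1 hq
      exact (Nat.lt_succ_self _).trans_eq (depth_eq_succ hr).symm
    | hr e =>
      obtain ⟨r, hr, rfl⟩ := Option.map_eq_some_iff.1 hq
      exact (Nat.lt_succ_self _).trans_eq (depth_eq_succ hr).symm)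

/-- The first morphism into the pushout. -/
noncomputable def pushoutInl : E ⟶ pushoutObj f g :=
  homMk (F := pushoutObj f g) FunPushout.inl fun e => by
    exact immPred_ofParent _ _ _ _

/-- The second morphism into the pushout. -/
noncomputable def pushoutInr : F ⟶ pushoutObj f g :=
  homMk (F := pushoutObj f g) FunPushout.inr fun e => by
    exact immPred_ofParent _ _ _ _

/-- The morphism out of the pushout induced by a compatible pair of morphisms. -/
noncomputable def pushoutDesc {T : TreeOrd.{u}} (a : E ⟶ T) (b : F ⟶ T)
    (h : ∀ t, a.toOrderHom (f.toOrderHom t) = b.toOrderHom (g.toOrderHom t)) :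
    pushoutObj f g ⟶ T :=
  homMk (E := pushoutObj f g) (FunPushout.desc a.toOrderHom b.toOrderHom h) fun x => by
    refine Eq.trans ?_ (congrArg (Option.map _) (immPred_ofParent _ _ _ _).symm)
    induction x using FunPushout.ind with
    | hl e =>
      exact (a.strict e).trans
        (Option.map_map (FunPushout.desc _ _ h) FunPushout.inl (immPred e)).symm
    | hr e =>
      exact (b.strict e).trans
        (Option.map_map (FunPushout.desc _ _ h) FunPushout.inr (immPred e)).symm

end Pushout

end TreeOrd

end HierGraph

/-! ### Hierarchical graphs and their underlying sets -/

namespace HGraph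

open HierGraph

theorem hom_ext {G H : HGraph.{u}} {f g : G ⟶ H}
    (he : ∀ e, f.edgeMap.toOrderHom e = g.edgeMap.toOrderHom e)
    (hv : ∀ v, f.nodeMap v = g.nodeMap v) : f = g :=
  Hom.ext (TreeOrd.Hom.ext (OrderHom.ext _ _ (funext he))) (funext hv)

/-- The functor sending a hierarchical graph to the disjoint union of its edges and nodes. -/
def elements : HGraph.{u} ⥤ Type u where
  obj G := G.edges ⊕ G.nodes
  map f := ↾(Sum.map f.edgeMap.toOrderHom f.nodeMap)
  map_id G := by ext (x | x) <;> rfl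
  map_comp f g := by ext (x | x) <;> rfl

theorem edge_comm {W X Y Z : HGraph.{u}} {f : W ⟶ X} {g : W ⟶ Y} {h : X ⟶ Z} {i : Y ⟶ Z}
    (w : f ≫ h = g ≫ i) (e : W.edges) :
    h.edgeMap.toOrderHom (f.edgeMap.toOrderHom e) =
      i.edgeMap.toOrderHom (g.edgeMap.toOrderHom e) :=
  congrArg (fun k : W ⟶ Z => k.edgeMap.toOrderHom e) w

theorem node_comm {W X Y Z : HGraph.{u}} {f : W ⟶ X} {g : W ⟶ Y} {h : X ⟶ Z} {i : Y ⟶ Z}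
    (w : f ≫ h = g ≫ i) (v : W.nodes) :
    h.nodeMap (f.nodeMap v) = i.nodeMap (g.nodeMap v) :=
  congrArg (fun k : W ⟶ Z => k.nodeMap v) w

instance : elements.{u}.ReflectsIsomorphisms where
  reflects {G H} f hf := by
    have hb : Function.Bijective (Sum.map f.edgeMap.toOrderHom f.nodeMap) :=
      (isIso_iff_bijective (elements.map f)).1 hf
    rw [Sum.map_bijective] at hb
    let ee := Equiv.ofBijective _ hb.1
    let ev := Equiv.ofBijective _ hb.2
    have hee : ∀ e, f.edgeMap.toOrderHom (ee.symm e) = e := ee.apply_symm_apply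
    have hev : ∀ v, f.nodeMap (ev.symm v) = v := ev.apply_symm_apply
    let k : H ⟶ G :=
      { edgeMap := TreeOrd.homMk ee.symm fun e => by
          -- As the edge map is injective, strictness of the inverse may be checked after applying
          -- it.
          apply Option.map_injective hb.1.1
          have hid : f.edgeMap.toOrderHom ∘ ee.symm = id := funext hee
          rw [← f.edgeMap.strict, hee, Option.map_map, hid, Option.map_id, id]
        nodeMap := ev.symm
        src_comm := fun e => hb.2.1 ((f.src_comm _).symm.trans
          ((congrArg H.src (hee e)).trans (hev _).symm))
        tgt_comm := fun e => hb.2.1 ((f.tgt_comm _).symm.trans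
          ((congrArg H.tgt (hee e)).trans (hev _).symm)) }
    exact ⟨k, hom_ext ee.symm_apply_apply ev.symm_apply_apply, hom_ext hee hev⟩

theorem exists_isPullback {X Y Z : HGraph.{u}} (f : X ⟶ Z) (g : Y ⟶ Z) :
    ∃ (P : HGraph.{u}) (a : P ⟶ X) (b : P ⟶ Y), IsPullback a b f g ∧
      IsPullback (elements.map a) (elements.map b) (elements.map f) (elements.map g) := by
  let P : HGraph.{u} :=
    { edges := TreeOrd.pullbackObj f.edgeMap g.edgeMap
      nodes := {v : X.nodes × Y.nodes // f.nodeMap v.1 = g.nodeMap v.2}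
      src := fun e => ⟨(X.src e.1.1, Y.src e.1.2), by
        rw [← f.src_comm, ← g.src_comm]; exact congrArg Z.src e.2⟩
      tgt := fun e => ⟨(X.tgt e.1.1, Y.tgt e.1.2), by
        rw [← f.tgt_comm, ← g.tgt_comm]; exact congrArg Z.tgt e.2⟩ }
  let a : P ⟶ X := ⟨TreeOrd.pullbackFst _ _, fun v => v.1.1, fun _ => rfl, fun _ => rfl⟩
  let b : P ⟶ Y := ⟨TreeOrd.pullbackSnd _ _, fun v => v.1.2, fun _ => rfl, fun _ => rfl⟩
  have w : a ≫ f = b ≫ g := hom_ext (fun e => e.2) (fun v => v.2)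
  refine ⟨P, a, b, ⟨⟨w⟩, ⟨PullbackCone.IsLimit.mk _
    (fun s => ⟨TreeOrd.pullbackLift _ _ s.fst.edgeMap s.snd.edgeMap (edge_comm s.condition),
      fun v => ⟨(s.fst.nodeMap v, s.snd.nodeMap v), node_comm s.condition v⟩,
      fun e => Subtype.ext (Prod.ext (s.fst.src_comm e) (s.snd.src_comm e)),
      fun e => Subtype.ext (Prod.ext (s.fst.tgt_comm e) (s.snd.tgt_comm e))⟩)
    (fun _ => rfl) (fun _ => rfl) (fun s m h₁ h₂ => hom_ext
      (fun e => Subtype.ext (Prod.ext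
        (congrArg (fun k : s.pt ⟶ X => k.edgeMap.toOrderHom e) h₁)
        (congrArg (fun k : s.pt ⟶ Y => k.edgeMap.toOrderHom e) h₂)))
      (fun v => Subtype.ext (Prod.ext
        (congrArg (fun k : s.pt ⟶ X => k.nodeMap v) h₁)
        (congrArg (fun k : s.pt ⟶ Y => k.nodeMap v) h₂))))⟩⟩, ?_⟩
  rw [Types.isPullback_iff]
  refine ⟨by rw [← elements.map_comp, w, elements.map_comp], ?_, ?_⟩
  -- Maps in the image of `elements` respect the summands, so the mixed cases are void.
  · rintro (x | x) (y | y) ⟨h₁, h₂⟩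
    · exact congrArg Sum.inl (Subtype.ext (Prod.ext (Sum.inl_injective h₁) (Sum.inl_injective h₂)))
    · exact absurd h₁ Sum.inl_ne_inr
    · exact absurd h₁ Sum.inr_ne_inl
    · exact congrArg Sum.inr (Subtype.ext (Prod.ext (Sum.inr_injective h₁) (Sum.inr_injective h₂)))
  · rintro (x | x) (y | y) h
    · exact ⟨Sum.inl ⟨(x, y), Sum.inl_injective h⟩, rfl, rfl⟩
    · exact absurd h Sum.inl_ne_inr
    · exact absurd h Sum.inr_ne_inl
    · exact ⟨Sum.inr ⟨(x, y), Sum.inr_injective h⟩, rfl, rfl⟩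

theorem exists_isPushout {X Y Z : HGraph.{u}} (f : Z ⟶ X) (g : Z ⟶ Y) :
    ∃ (P : HGraph.{u}) (a : X ⟶ P) (b : Y ⟶ P), IsPushout f g a b ∧
      IsPushout (elements.map f) (elements.map g) (elements.map a) (elements.map b) := by
  let P : HGraph.{u} :=
    { edges := TreeOrd.pushoutObj f.edgeMap g.edgeMap
      nodes := FunPushout f.nodeMap g.nodeMap
      src := FunPushout.desc (fun e => .inl (X.src e)) (fun e => .inr (Y.src e)) fun e => by
        rw [f.src_comm, g.src_comm, FunPushout.condition]
      tgt := FunPushout.desc (fun e => .inl (X.tgt e)) (fun e => .inr (Y.tgt e)) fun e => by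
        rw [f.tgt_comm, g.tgt_comm, FunPushout.condition] }
  let a : X ⟶ P := ⟨TreeOrd.pushoutInl _ _, FunPushout.inl, fun _ => rfl, fun _ => rfl⟩
  let b : Y ⟶ P := ⟨TreeOrd.pushoutInr _ _, FunPushout.inr, fun _ => rfl, fun _ => rfl⟩
  have w : f ≫ a = g ≫ b := hom_ext FunPushout.condition FunPushout.condition
  refine ⟨P, a, b, ⟨⟨w⟩, ⟨PushoutCocone.IsColimit.mk _
    (fun s => ⟨TreeOrd.pushoutDesc _ _ s.inl.edgeMap s.inr.edgeMap (edge_comm s.condition),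
      FunPushout.desc s.inl.nodeMap s.inr.nodeMap (node_comm s.condition),
      FunPushout.ind s.inl.src_comm s.inr.src_comm,
      FunPushout.ind s.inl.tgt_comm s.inr.tgt_comm⟩)
    (fun _ => rfl) (fun _ => rfl) (fun s m h₁ h₂ => hom_ext
      (FunPushout.ind (fun e => congrArg (fun k : X ⟶ s.pt => k.edgeMap.toOrderHom e) h₁)
        (fun e => congrArg (fun k : Y ⟶ s.pt => k.edgeMap.toOrderHom e) h₂))
      (FunPushout.ind (fun v => congrArg (fun k : X ⟶ s.pt => k.nodeMap v) h₁)
        (fun v => congrArg (fun k : Y ⟶ s.pt => k.nodeMap v) h₂)))⟩⟩,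
    ⟨⟨by rw [← elements.map_comp, w, elements.map_comp]⟩, ⟨PushoutCocone.IsColimit.mk _
      (fun s => ↾(Sum.elim
        (FunPushout.desc (fun e => s.inl (.inl e)) (fun e => s.inr (.inl e))
          fun e => ConcreteCategory.congr_hom s.condition (.inl e))
        (FunPushout.desc (fun v => s.inl (.inr v)) (fun v => s.inr (.inr v))
          fun v => ConcreteCategory.congr_hom s.condition (.inr v))))
      (fun s => by ext (x | x) <;> rfl) (fun s => by ext (x | x) <;> rfl)
      (fun s m h₁ h₂ => ?_)⟩⟩⟩
  ext (x | x) <;> revert x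
  · exact FunPushout.ind (fun e => ConcreteCategory.congr_hom h₁ (.inl e))
      (fun e => ConcreteCategory.congr_hom h₂ (.inl e))
  · exact FunPushout.ind (fun v => ConcreteCategory.congr_hom h₁ (.inr v))
      (fun v => ConcreteCategory.congr_hom h₂ (.inr v))

instance : HasPullbacks HGraph.{u} :=
  have {X Y Z : HGraph.{u}} {f : X ⟶ Z} {g : Y ⟶ Z} : HasLimit (cospan f g) :=
    let ⟨_, _, _, h, _⟩ := exists_isPullback f g
    h.hasPullback
  hasPullbacks_of_hasLimit_cospan _

instance : HasPushouts HGraph.{u} :=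
  have {X Y Z : HGraph.{u}} {f : Z ⟶ X} {g : Z ⟶ Y} : HasColimit (span f g) :=
    let ⟨_, _, _, h, _⟩ := exists_isPushout f g
    h.hasPushout
  hasPushouts_of_hasColimit_span _

/-- Preservation need only be checked on one limit cone, here the explicit one. -/
instance : PreservesLimitsOfShape WalkingCospan elements.{u} where
  preservesLimit {K} := by
    obtain ⟨P, a, b, h, h'⟩ :=
      exists_isPullback (K.map WalkingCospan.Hom.inl) (K.map WalkingCospan.Hom.inr)
    have := preservesLimit_of_preserves_limit_cone (F := elements) h.isLimit
      ((isLimitMapConePullbackConeEquiv elements h.w).symm h'.isLimit)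
    exact preservesLimit_of_iso_diagram elements (diagramIsoCospan K).symm

instance : PreservesColimitsOfShape WalkingSpan elements.{u} where
  preservesColimit {K} := by
    obtain ⟨P, a, b, h, h'⟩ :=
      exists_isPushout (K.map WalkingSpan.Hom.fst) (K.map WalkingSpan.Hom.snd)
    have := preservesColimit_of_preserves_colimit_cocone (F := elements) h.isColimit
      ((isColimitMapCoconePushoutCoconeEquiv elements h.w).symm h'.isColimit)
    exact preservesColimit_of_iso_diagram elements (diagramIsoSpan K).symm

end HGraph

theorem mainTheorem5 : CategoryTheory.Adhesive HGraph.{u} := by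
  exact adhesive_of_preserves_and_reflects_isomorphism HGraph.elements
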